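/- **Setting.** Let $K$ be a field with $\operatorname{char} K\neq 2$, let $\Lambda$ be a finite-dimensional $K$-algebra, and let $G$ be a finite group acting on $\Lambda$ by $K$-algebra automorphisms (for instance $G=\mathbb Z/2=\langle g\rangle$). Let $\bar\Lambda=\Lambda G$ be the skew group algebra, with $(\lambda g)(\mu h)=\lambda\, g(\mu)\, gh$. Modules are left modules. For a $\Lambda$-module $M$ let ${}^gM$ be the same abelian group with $\lambda\in\Lambda$ acting as $g^{-1}(\lambda)$ does on $M$, and let $$F_\lambda(M)=\bar\Lambda\otimes_\Lambda M=\bigoplus_{g\in G} g\otimes M,\qquad F_\lambda(f)=\mathrm{id}\otimes f,$$ be the Galois semi-covering push-down functor $F_\lambda:\mathrm{mod}\text{-}\Lambda\to\mathrm{mod}\text{-}\bar\Lambda$. **Pointed modules.** Let $R$ be a ring and $\theta$ a finitely presented $R$-module. A $\theta$-pointed $R$-module $(M,\chi_M)$ is a finitely presented $R$-module $M$ with a homomorphism $\chi_M:\theta\to M$; a pointed homomorphism $(M,\chi_M)\to(N,\chi_N)$ is a homomorphism $f:M\to N$ with $f\chi_M=\chi_N$. Put $(M,\chi_M)\oplus(N,\chi_N)=(M\oplus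 N,(\chi_M,\chi_N))$, and let $(M,\chi_M)*(N,\chi_N)=(M*N,\chi_{M*N})$ be the pushout $M*N=(M\oplus N)/\{(\chi_M(l),-\chi_N(l)):l\in\theta\}$ with the induced homomorphism $\chi_{M*N}$ from $\theta$. Write $\overline{M}\le\overline{N}$ if there is a pointed homomorphism $(N,\chi_N)\to(M,\chi_M)$; identifying pointed modules that admit pointed homomorphisms in both directions gives a lattice $\mathcal P_R^\theta$ with $\overline{M}\vee\overline{N}=\overline{M\oplus N}$ and $\overline{M}\wedge\overline{N}=\overline{M*N}$. A subset $S\subseteq\mathcal P_R^\theta$ is *wide* if for all $a<b$ in $S$ there are incomparable $c,d\in S$ with $a<c,d<b$ and $a<c\wedge d<c\vee d<b$ (meet and join taken in $\mathcal P_R^\theta$). A *dense chain* of $\theta$-pointed $R$-modules is a family $(M_q,\chi_{M_q})_{q\in C}$, indexed by a non-empty dense linear order $C$ without end points, such that: $\operatorname{End}_R(M_q)$ is local and $\chi_{M_q}\ne0$ for all $q$; there is a pointed homomorphism $(M_q,\chi_{M_q})\to(M_{q'},\chi_{M_{q'}})$ whenever $q<q'$; and $(M_q,\chi_{M_q})$,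 $(M_{q'},\chi_{M_{q'}})$ are not isomorphic as pointed modules for $q\ne q'$. Two dense chains $(M_q)_{q\in C_1}$, $(N_t)_{t\in C_2}$ form an *independent pair* if $\operatorname{End}_R(M_q*N_t)$ is local for all $q,t$, and the pointed module $M_q*N_t$ is isomorphic, as a pointed module, neither to $M_{q'}*N_t$ for any $q'\ne q$ nor to $M_q*N_{t'}$ for any $t'\ne t$. For $R=\Lambda$, the independent pair is *non-symmetric* if for every $1\ne g\in G$, all $q_1,q_2\in C_1$ and all $t_1,t_2\in C_2$, as $\Lambda$-modules, $${}^gM_{q_1}\not\cong M_{q_2},\qquad {}^gN_{t_1}\not\cong N_{t_2},\qquad {}^g(M_{q_1}*N_{t_1})\not\cong M_{q_2}*N_{t_2}.$$ **Theorem.** Let $\theta$ be a finitely presented semisimple $\Lambda$-module. 1. If $\big((M_q,\chi_{M_q})_{q\in C_1},(N_t,\chi_{N_t})_{t\in C_2}\big)$ is a non-symmetric independent pair of dense chains of $\theta$-pointed $\Lambda$-modules, then $\big((F_\lambda(M_q),F_\lambda(\chi_{M_q}))_{q\in C_1},(F_\lambda(N_t),F_\lambda(\chi_{N_t}))_{t\in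 C_2}\big)$ is an independent pair of dense chains of $F_\lambda(\theta)$-pointed $\bar\Lambda$-modules. 2. If $(M_p,\chi_{M_p})_{p\in P}$ is a family of $\theta$-pointed $\Lambda$-modules whose classes form a wide subset of $\mathcal P_\Lambda^\theta$, then the classes of $(F_\lambda(M_p),F_\lambda(\chi_{M_p}))_{p\in P}$ form a wide subset of $\mathcal P_{\bar\Lambda}^{F_\lambda(\theta)}$; moreover, if the first subset contains two elements $a<b$, then so does the second. -/

import Mathlib

set_option linter.unusedSectionVars false

noncomputable section

/-! ### Skew group algebras, twisted modules and the push-down functor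

The skew group algebra of a group `G` acting on a ring `Λ` by ring automorphisms is
`SkewMonoidAlgebra Λ G`, with `(single g a) * (single h b) = single (g * h) (a * (g • b))`.
All modules are left modules. -/

/-- The twisted module `ᵍM = M ∘ g⁻¹`: the same abelian group as `M`, on which `a : Λ` acts as
`g⁻¹ • a` does on `M`. -/
def Twist {G : Type*} (_g : G) (M : Type*) : Type _ := M

namespace Twist

variable {G Λ M : Type*} [Group G] [Ring Λ] [MulSemiringAction G Λ] [AddCommGroup M] [Module Λ M]

instance (g : G) : AddCommGroup (Twist g M) := inferInstanceAs (AddCommGroup M)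

instance (g : G) : Module Λ (Twist g M) :=
  Module.compHom M (MulSemiringAction.toRingHom G Λ g⁻¹)

theorem smul_def (g : G) (a : Λ) (m : M) :
    (a • (show Twist g M from m) : Twist g M) = (show Twist g M from (g⁻¹ • a) • m) := rfl

end Twist

/-- The push-down of a `Λ`-module `M` to the skew group algebra, for a finite group `G`:
the induced module `(skew group algebra) ⊗_Λ M = ⨁_{g ∈ G} g ⊗ M`. The function `φ : G → M`
stands for `∑ g, g ⊗ φ g`. See `Pushdown.existsUnique_lift` for the universal property of this
tensor product. -/
def Pushdown (G : Type*) (M : Type*) : Type _ := G → M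

namespace Pushdown

variable {G Λ M N P : Type*} [Group G] [Ring Λ] [MulSemiringAction G Λ]
  [AddCommGroup M] [Module Λ M] [AddCommGroup N] [Module Λ N] [AddCommGroup P] [Module Λ P]

instance : AddCommGroup (Pushdown G M) := inferInstanceAs (AddCommGroup (G → M))

instance : FunLike (Pushdown G M) G M := ⟨fun φ => φ, fun _ _ h => h⟩

/-- The element `∑ g, g ⊗ f g`. -/
def of (f : G → M) : Pushdown G M := f

@[simp] theorem of_apply (f : G → M) (g : G) : of f g = f g := rfl

@[ext] theorem ext {φ ψ : Pushdown G M} (h : ∀ g : G, φ g = ψ g) : φ = ψ := funext h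

@[simp] theorem add_apply (φ ψ : Pushdown G M) (g : G) : (φ + ψ) g = φ g + ψ g := rfl

@[simp] theorem zero_apply (g : G) : (0 : Pushdown G M) g = 0 := rfl

variable (G Λ M) in
/-- `a • (x ⊗ m) = x ⊗ (x⁻¹ • a) • m` for `a : Λ`. -/
def scalarHom : Λ →+* AddMonoid.End (Pushdown G M) where
  toFun a :=
    { toFun := fun φ => of fun x => (x⁻¹ • a) • φ x
      map_zero' := by ext; simp
      map_add' := fun φ ψ => by ext; simp }
  map_one' := by
    ext φ x
    change (x⁻¹ • (1 : Λ)) • φ x = φ x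
    rw [smul_one, one_smul]
  map_mul' a b := by
    ext φ x
    change (x⁻¹ • (a * b)) • φ x = (x⁻¹ • a) • (x⁻¹ • b) • φ x
    rw [smul_mul', mul_smul]
  map_zero' := by
    ext φ x
    change (x⁻¹ • (0 : Λ)) • φ x = 0
    rw [smul_zero, zero_smul]
  map_add' a b := by
    ext φ x
    change (x⁻¹ • (a + b)) • φ x = (x⁻¹ • a) • φ x + (x⁻¹ • b) • φ x
    rw [smul_add, add_smul]

variable (G M) in
/-- `h • (x ⊗ m) = (h * x) ⊗ m` for `h : G`. -/
def groupHom : G →* AddMonoid.End (Pushdown G M) where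
  toFun h :=
    { toFun := fun φ => of fun x => φ (h⁻¹ * x)
      map_zero' := rfl
      map_add' := fun _ _ => rfl }
  map_one' := by
    ext φ x
    change φ (1⁻¹ * x) = φ x
    simp
  map_mul' h k := by
    ext φ x
    change φ ((h * k)⁻¹ * x) = φ (k⁻¹ * (h⁻¹ * x))
    simp [mul_assoc]

theorem scalarHom_comp_groupHom {a : Λ} {h : G} :
    scalarHom G Λ M (h • a) * groupHom G M h = groupHom G M h * scalarHom G Λ M a := by
  ext φ x
  change (x⁻¹ • h • a) • φ (h⁻¹ * x) = ((h⁻¹ * x)⁻¹ • a) • φ (h⁻¹ * x)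
  simp [mul_smul]

variable (G Λ M) in
/-- The action of the skew group algebra: `single h a` acts as
`x ⊗ m ↦ (h * x) ⊗ ((h * x)⁻¹ • a) • m`. -/
def actionHom : SkewMonoidAlgebra Λ G →+* AddMonoid.End (Pushdown G M) :=
  SkewMonoidAlgebra.liftNCRingHom (scalarHom G Λ M) (groupHom G M) scalarHom_comp_groupHom

instance : Module (SkewMonoidAlgebra Λ G) (Pushdown G M) :=
  Module.compHom (Pushdown G M) (actionHom G Λ M)

@[simp] theorem single_smul_apply (h : G) (a : Λ) (φ : Pushdown G M) (x : G) :
    (SkewMonoidAlgebra.single h a • φ) x = (x⁻¹ • a) • φ (h⁻¹ * x) := by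
  have : actionHom G Λ M (SkewMonoidAlgebra.single h a) = scalarHom G Λ M a * groupHom G M h :=
    SkewMonoidAlgebra.liftNC_single _ _ _ _
  change (actionHom G Λ M (SkewMonoidAlgebra.single h a) φ) x = _
  rw [this]
  rfl

/-- The push-down of a homomorphism: `g ⊗ m ↦ g ⊗ f m`. -/
def map (f : M →ₗ[Λ] N) : Pushdown G M →ₗ[SkewMonoidAlgebra Λ G] Pushdown G N where
  toFun φ := of fun x => f (φ x)
  map_add' φ ψ := by ext; simp
  map_smul' s φ := by
    induction s with
    | single h a => ext x; simp
    | add s t hs ht =>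
      rw [RingHom.id_apply] at hs ht ⊢
      rw [add_smul, add_smul, ← hs, ← ht]
      ext x
      simp

@[simp] theorem map_apply (f : M →ₗ[Λ] N) (φ : Pushdown G M) (x : G) : map f φ x = f (φ x) := rfl

open Classical in
variable (G) in
/-- The canonical map `M → Pushdown G M`, `m ↦ 1 ⊗ m`. -/
def unit (m : M) : Pushdown G M := of fun x => if x = 1 then m else 0

theorem sum_apply {ι : Type*} (s : Finset ι) (F : ι → Pushdown G M) (x : G) :
    (∑ i ∈ s, F i) x = ∑ i ∈ s, F i x := Finset.sum_apply x s F

theorem eq_sum [Fintype G] (φ : Pushdown G M) :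
    φ = ∑ g, SkewMonoidAlgebra.single g (1 : Λ) • unit G (φ g) := by
  classical
  ext x
  rw [sum_apply, Finset.sum_eq_single x]
  · simp [unit]
  · intro g _ hg
    simp [unit, inv_mul_eq_one, hg]
  · simp

/-- The universal property of `(skew group algebra) ⊗_Λ M`. -/
theorem existsUnique_lift [Finite G] {X : Type*} [AddCommGroup X]
    [Module (SkewMonoidAlgebra Λ G) X] (f : M →+ X)
    (hf : ∀ (a : Λ) (m : M), f (a • m) = SkewMonoidAlgebra.single (1 : G) a • f m) :
    ∃! F : Pushdown G M →ₗ[SkewMonoidAlgebra Λ G] X, ∀ m, F (unit G m) = f m := by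
  classical
  have := Fintype.ofFinite G
  refine ⟨{ toFun := fun φ => ∑ g, SkewMonoidAlgebra.single g (1 : Λ) • f (φ g)
            map_add' := ?_, map_smul' := ?_ }, ?_, ?_⟩
  · intro φ ψ
    simp [Finset.sum_add_distrib]
  · intro s φ
    induction s with
    | single h a =>
      simp only [single_smul_apply, RingHom.id_apply, Finset.smul_sum, hf, smul_smul,
        SkewMonoidAlgebra.single_mul_single, mul_one, one_mul, smul_one]
      refine Fintype.sum_equiv (Equiv.mulLeft h⁻¹) _ _ fun x => ?_
      simp
    | add s t hs ht =>
      simp only [RingHom.id_apply, add_smul, add_apply, map_add, smul_add,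
        Finset.sum_add_distrib] at hs ht ⊢
      rw [hs, ht]
  · intro m
    change ∑ g, SkewMonoidAlgebra.single g (1 : Λ) • f (unit G m g) = f m
    rw [Finset.sum_eq_single 1]
    · simp [unit, SkewMonoidAlgebra.single_one_one]
    · intro g _ hg
      simp [unit, hg]
    · simp
  · intro F hF
    ext φ
    conv_lhs => rw [eq_sum (Λ := Λ) φ]
    simp only [map_sum, map_smul, hF]
    rfl

section FinitePresentation

variable [Finite G]

/-- The push-down of the regular module is the regular module. -/
def regularEquiv : SkewMonoidAlgebra Λ G ≃ₗ[SkewMonoidAlgebra Λ G] Pushdown G Λ :=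
  LinearEquiv.ofBijective (LinearMap.toSpanSingleton _ _ (unit G (1 : Λ))) <| by
    have key : ∀ (s : SkewMonoidAlgebra Λ G) (x : G),
        (s • unit G (1 : Λ)) x = x⁻¹ • s.coeff x := by
      intro s x
      classical
      induction s with
      | single h a =>
        rw [single_smul_apply, SkewMonoidAlgebra.coeff_single_apply]
        simp only [unit, of_apply, inv_mul_eq_one]
        split_ifs <;> simp
      | add s t hs ht =>
        rw [add_smul, add_apply, hs, ht, SkewMonoidAlgebra.coeff_add, Finsupp.add_apply, smul_add]
    constructor
    · rw [injective_iff_map_eq_zero]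
      intro s hs
      ext x
      have h : (s • unit G (1 : Λ)) x = 0 := DFunLike.congr_fun hs x
      rw [key] at h
      have := congrArg (x • ·) h
      simpa using this
    · intro φ
      refine ⟨⟨Finsupp.equivFunOnFinite.symm fun x => x • φ x⟩, ?_⟩
      ext x
      change ((_ : SkewMonoidAlgebra Λ G) • unit G (1 : Λ)) x = _
      rw [key]
      simp

variable (G Λ) in
/-- The push-down commutes with finite powers. -/
def piEquiv (n : ℕ) :
    Pushdown G (Fin n → Λ) ≃ₗ[SkewMonoidAlgebra Λ G] (Fin n → Pushdown G Λ) where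
  __ := LinearMap.pi fun i => map (LinearMap.proj (R := Λ) (φ := fun _ : Fin n => Λ) i)
  invFun ψ := of fun x i => ψ i x
  left_inv _ := rfl
  right_inv _ := rfl

/-- The push-down of a finitely presented module is finitely presented. -/
instance [Module.FinitePresentation Λ M] :
    Module.FinitePresentation (SkewMonoidAlgebra Λ G) (Pushdown G M) := by
  have free (n : ℕ) :
      Module.FinitePresentation (SkewMonoidAlgebra Λ G) (Pushdown G (Fin n → Λ)) :=
    .of_equiv ((LinearEquiv.piCongrRight fun _ => regularEquiv).trans (piEquiv G Λ n).symm)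
  obtain ⟨n, m, f, g, hf, hfg⟩ := Module.FinitePresentation.exists_fin' Λ M
  have := free n
  have := free m
  refine Module.finitePresentation_of_surjective (map f) ?_ ?_
  · intro φ
    choose ψ hψ using fun x => hf (φ x)
    exact ⟨of ψ, ext hψ⟩
  · have : LinearMap.ker (map (G := G) f) = LinearMap.range (map g) := by
      ext φ
      constructor
      · intro h
        choose ψ hψ using fun x => (hfg (φ x)).1 (DFunLike.congr_fun h x)
        exact ⟨of ψ, ext hψ⟩
      · rintro ⟨ψ, rfl⟩
        exact ext fun x => (hfg _).2 ⟨ψ x, rfl⟩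
    rw [this, LinearMap.range_eq_map]
    exact Module.Finite.fg_top.map _

end FinitePresentation

end Pushdown

/-! ### Pointed modules -/

/-- A `θ`-pointed `R`-module: a finitely presented module `M` with a homomorphism `θ → M`. -/
structure PointedModule.{v, u, w} (R : Type u) [Ring R] (θ : Type w) [AddCommGroup θ] [Module R θ] :
    Type (max u w (v + 1)) where
  carrier : Type v
  [addCommGroup : AddCommGroup carrier]
  [module : Module R carrier]
  [finitePresentation : Module.FinitePresentation R carrier]
  /-- the homomorphism `χ_M : θ → M` -/
  pt : θ →ₗ[R] carrier

namespace PointedModule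

attribute [instance] addCommGroup module finitePresentation

universe v u w

variable {R : Type u} [Ring R] {θ : Type w} [AddCommGroup θ] [Module R θ]

/-- Existence of a pointed homomorphism `(M, χ_M) → (N, χ_N)`. -/
def HasHom (M N : PointedModule.{v} R θ) : Prop :=
  ∃ f : M.carrier →ₗ[R] N.carrier, f ∘ₗ M.pt = N.pt

/-- Existence of a pointed isomorphism `(M, χ_M) → (N, χ_N)`. -/
def IsIso (M N : PointedModule.{v} R θ) : Prop :=
  ∃ e : M.carrier ≃ₗ[R] N.carrier, e.toLinearMap ∘ₗ M.pt = N.pt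

/-- `M ≤ N` if and only if there is a pointed homomorphism from `N` to `M`. -/
instance : Preorder (PointedModule.{v} R θ) where
  le M N := HasHom N M
  le_refl _ := ⟨LinearMap.id, rfl⟩
  le_trans _ _ _ := fun ⟨f, hf⟩ ⟨g, hg⟩ => ⟨f ∘ₗ g, by rw [LinearMap.comp_assoc, hg, hf]⟩

/-- The pointed direct sum `(M ⊕ N, l ↦ (χ_M l, χ_N l))`. -/
abbrev directSum (M N : PointedModule.{v} R θ) : PointedModule.{v} R θ where
  carrier := M.carrier × N.carrier
  pt := M.pt.prod N.pt

/-- The submodule `{(χ_M l, - χ_N l) : l ∈ θ}` of `M ⊕ N`. -/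
def pushoutRel (M N : PointedModule.{v} R θ) : Submodule R (M.carrier × N.carrier) :=
  LinearMap.range (M.pt.prod (-N.pt))

/-- The pointed pushout `M * N` of `χ_M` and `χ_N`, with the point
`l ↦ [(χ_M l, 0)] = [(0, χ_N l)]`. -/
abbrev pushout [Module.FinitePresentation R θ] (M N : PointedModule.{v} R θ) :
    PointedModule.{v} R θ where
  carrier := (M.carrier × N.carrier) ⧸ pushoutRel M N
  finitePresentation :=
    Module.finitePresentation_of_surjective (pushoutRel M N).mkQ
      (Submodule.mkQ_surjective _) (by
        rw [Submodule.ker_mkQ, pushoutRel, LinearMap.range_eq_map]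
        exact Module.Finite.fg_top.map _)
  pt := (pushoutRel M N).mkQ ∘ₗ LinearMap.inl R M.carrier N.carrier ∘ₗ M.pt

theorem pushout_pt_eq [Module.FinitePresentation R θ] (M N : PointedModule.{v} R θ) :
    (pushout M N).pt = (pushoutRel M N).mkQ ∘ₗ LinearMap.inr R M.carrier N.carrier ∘ₗ N.pt := by
  ext l
  refine (Submodule.Quotient.eq _).2 ⟨l, ?_⟩
  simp

/-- The poset of `θ`-pointed modules: classes of pointed modules modulo the relation
"there are pointed homomorphisms in both directions". -/
abbrev Classes (R : Type u) [Ring R] (θ : Type w) [AddCommGroup θ] [Module R θ] :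
    Type (max u w (v + 1)) :=
  Antisymmetrization (PointedModule.{v} R θ) (· ≤ ·)

/-- The class of a pointed module. -/
def cls (M : PointedModule.{v} R θ) : Classes.{v} R θ := toAntisymmetrization (· ≤ ·) M

theorem cls_le_cls_iff (M N : PointedModule.{v} R θ) : cls M ≤ cls N ↔ HasHom N M := Iff.rfl

theorem directSum_le_iff (M N L : PointedModule.{v} R θ) :
    directSum M N ≤ L ↔ M ≤ L ∧ N ≤ L := by
  constructor
  · rintro ⟨f, hf⟩
    exact ⟨⟨LinearMap.fst R _ _ ∘ₗ f, by rw [LinearMap.comp_assoc, hf]; rfl⟩,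
      ⟨LinearMap.snd R _ _ ∘ₗ f, by rw [LinearMap.comp_assoc, hf]; rfl⟩⟩
  · rintro ⟨⟨f, hf⟩, ⟨g, hg⟩⟩
    exact ⟨f.prod g, LinearMap.ext fun l =>
      Prod.ext (LinearMap.congr_fun hf l) (LinearMap.congr_fun hg l)⟩

theorem le_pushout_iff [Module.FinitePresentation R θ] (M N L : PointedModule.{v} R θ) :
    L ≤ pushout M N ↔ L ≤ M ∧ L ≤ N := by
  constructor
  · rintro ⟨f, hf⟩
    refine ⟨⟨f ∘ₗ (pushoutRel M N).mkQ ∘ₗ LinearMap.inl R _ _, ?_⟩,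
      ⟨f ∘ₗ (pushoutRel M N).mkQ ∘ₗ LinearMap.inr R _ _, ?_⟩⟩
    · rw [← hf]; rfl
    · rw [← hf, pushout_pt_eq]; rfl
  · rintro ⟨⟨f, hf⟩, ⟨g, hg⟩⟩
    refine ⟨(pushoutRel M N).liftQ (f.coprod g) ?_, ?_⟩
    · rintro _ ⟨l, rfl⟩
      have h1 := LinearMap.congr_fun hf l
      have h2 := LinearMap.congr_fun hg l
      simp only [LinearMap.comp_apply] at h1 h2
      simp [h1, h2]
    · ext l
      have h1 := LinearMap.congr_fun hf l
      simpa using h1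

/-- The poset of pointed modules is a lattice: suprema are direct sums, infima are pushouts. -/
instance [Module.FinitePresentation R θ] : Lattice (Classes.{v} R θ) where
  sup := Quotient.map₂ directSum fun M M' hM N N' hN =>
    ⟨(directSum_le_iff _ _ _).2 ⟨hM.1.trans ((directSum_le_iff _ _ _).1 le_rfl).1,
        hN.1.trans ((directSum_le_iff _ _ _).1 le_rfl).2⟩,
      (directSum_le_iff _ _ _).2 ⟨hM.2.trans ((directSum_le_iff _ _ _).1 le_rfl).1,
        hN.2.trans ((directSum_le_iff _ _ _).1 le_rfl).2⟩⟩
  le_sup_left := by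
    rintro ⟨M⟩ ⟨N⟩
    exact ((directSum_le_iff M N _).1 le_rfl).1
  le_sup_right := by
    rintro ⟨M⟩ ⟨N⟩
    exact ((directSum_le_iff M N _).1 le_rfl).2
  sup_le := by
    rintro ⟨M⟩ ⟨N⟩ ⟨L⟩ h1 h2
    exact (directSum_le_iff M N L).2 ⟨h1, h2⟩
  inf := Quotient.map₂ pushout fun M M' hM N N' hN =>
    ⟨(le_pushout_iff _ _ _).2 ⟨((le_pushout_iff _ _ _).1 le_rfl).1.trans hM.1,
        ((le_pushout_iff _ _ _).1 le_rfl).2.trans hN.1⟩,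
      (le_pushout_iff _ _ _).2 ⟨((le_pushout_iff _ _ _).1 le_rfl).1.trans hM.2,
        ((le_pushout_iff _ _ _).1 le_rfl).2.trans hN.2⟩⟩
  inf_le_left := by
    rintro ⟨M⟩ ⟨N⟩
    exact ((le_pushout_iff M N _).1 le_rfl).1
  inf_le_right := by
    rintro ⟨M⟩ ⟨N⟩
    exact ((le_pushout_iff M N _).1 le_rfl).2
  le_inf := by
    rintro ⟨L⟩ ⟨M⟩ ⟨N⟩ h1 h2
    exact (le_pushout_iff M N L).2 ⟨h1, h2⟩

theorem cls_sup [Module.FinitePresentation R θ] (M N : PointedModule.{v} R θ) :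
    cls M ⊔ cls N = cls (directSum M N) := rfl

theorem cls_inf [Module.FinitePresentation R θ] (M N : PointedModule.{v} R θ) :
    cls M ⊓ cls N = cls (pushout M N) := rfl

/-- A dense chain of `θ`-pointed modules, indexed by a dense chain without end points `C`. -/
structure IsDenseChain {C : Type*} [LinearOrder C] [DenselyOrdered C] [NoMinOrder C] [NoMaxOrder C]
    [Nonempty C] (M : C → PointedModule.{v} R θ) : Prop where
  isLocalRing_end : ∀ q, IsLocalRing (Module.End R (M q).carrier)
  pt_ne_zero : ∀ q, (M q).pt ≠ 0
  hasHom : ∀ q q', q < q' → HasHom (M q) (M q')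
  not_isIso : ∀ q q', q ≠ q' → ¬ IsIso (M q) (M q')

section Pairs

variable {C₁ C₂ : Type*}
  [LinearOrder C₁] [DenselyOrdered C₁] [NoMinOrder C₁] [NoMaxOrder C₁] [Nonempty C₁]
  [LinearOrder C₂] [DenselyOrdered C₂] [NoMinOrder C₂] [NoMaxOrder C₂] [Nonempty C₂]

/-- An independent pair of dense chains of `θ`-pointed modules. -/
structure IsIndependentPair [Module.FinitePresentation R θ]
    (M : C₁ → PointedModule.{v} R θ) (N : C₂ → PointedModule.{v} R θ) : Prop where
  left : IsDenseChain M
  right : IsDenseChain N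
  isLocalRing_end : ∀ q t, IsLocalRing (Module.End R (pushout (M q) (N t)).carrier)
  not_isIso_left : ∀ q q' t, q ≠ q' → ¬ IsIso (pushout (M q) (N t)) (pushout (M q') (N t))
  not_isIso_right : ∀ q t t', t ≠ t' → ¬ IsIso (pushout (M q) (N t)) (pushout (M q) (N t'))

/-- A non-symmetric independent pair of dense chains of `θ`-pointed modules, for an action of the
group `G` on `R`: no nontrivial twist of an `M q` (respectively `N t`, or pushout of `M q` and
`N t`) is isomorphic, as a module, to an `M q'` (respectively `N t'`, or pushout of `M q'` and
`N t'`). -/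
structure IsNonsymmetricPair (G : Type*) [Group G] [MulSemiringAction G R]
    [Module.FinitePresentation R θ]
    (M : C₁ → PointedModule.{v} R θ) (N : C₂ → PointedModule.{v} R θ) : Prop extends
    IsIndependentPair M N where
  left_twist : ∀ g : G, g ≠ 1 → ∀ q₁ q₂,
    IsEmpty (Twist g (M q₁).carrier ≃ₗ[R] (M q₂).carrier)
  right_twist : ∀ g : G, g ≠ 1 → ∀ t₁ t₂,
    IsEmpty (Twist g (N t₁).carrier ≃ₗ[R] (N t₂).carrier)
  pushout_twist : ∀ g : G, g ≠ 1 → ∀ q₁ t₁ q₂ t₂,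
    IsEmpty (Twist g (pushout (M q₁) (N t₁)).carrier ≃ₗ[R] (pushout (M q₂) (N t₂)).carrier)

end Pairs

/-- The push-down of a `θ`-pointed module `(M, χ_M)`, pointed by the push-down of `χ_M`. -/
abbrev pushdown (G : Type*) [Group G] [Finite G] [MulSemiringAction G R] (M : PointedModule.{v} R θ) :
    PointedModule (SkewMonoidAlgebra R G) (Pushdown G θ) where
  carrier := Pushdown G M.carrier
  pt := Pushdown.map M.pt

end PointedModule

/-- A subset `S` of a lattice is wide if between any two elements `a < b` of `S` there are two
incomparable elements `c, d` of `S` whose infimum and supremum (in the ambient lattice) lie strictly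
between `a` and `b`. -/
def IsWide {L : Type*} [Lattice L] (S : Set L) : Prop :=
  ∀ a ∈ S, ∀ b ∈ S, a < b → ∃ c ∈ S, ∃ d ∈ S, ¬ c ≤ d ∧ ¬ d ≤ c ∧
    a < c ∧ c < b ∧ a < d ∧ d < b ∧ a < c ⊓ d ∧ c ⊓ d < c ⊔ d ∧ c ⊔ d < b

end

noncomputable section

/-! ### Rings and modules with local endomorphism rings -/

/-! Everything rests on `component`, which sends a homomorphism `f` of push-downs to its degree-1
part `m ↦ f (1 ⊗ m) 1`. It is additive, sends the identity to the identity, and sends pointed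
homomorphisms to pointed homomorphisms.

Hence pointed homomorphisms `F M → F N` exist exactly when pointed homomorphisms `M → N` do
(`hasHom_pushdown_iff`). Since the push-down also commutes with direct sums and pushouts, it induces
an injective lattice homomorphism, and wideness passes to the image.

`component` is not multiplicative, so transferring locality and non-isomorphism takes more.
Restricted to `Λ`, the push-down of `M` is the direct sum of the twists `ᵍM`, and all diagonal
entries of an endomorphism are given by its `component`. If `End M` is local and no nontrivial twist
of `M` is isomorphic to `M`, the twists are pairwise non-isomorphic, so off-diagonal entries are
radical and an endomorphism is invertible once its component is (`isUnit_of_isUnit_component`). This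
makes the endomorphism ring of the push-down local. A Krull–Schmidt argument (`bijective_component`)
shows that an isomorphism of push-downs has a bijective component, so pointed isomorphisms descend.
-/

theorem IsLocalRing.of_ringEquiv {A B : Type*} [Ring A] [Ring B] [IsLocalRing A]
    (e : A ≃+* B) : IsLocalRing B :=
  have := e.symm.toEquiv.nontrivial
  .of_isUnit_or_isUnit_of_isUnit_add fun a b h => by
    rw [← isUnit_map_iff e.symm, map_add] at h
    simpa using IsLocalRing.isUnit_or_isUnit_of_isUnit_add h

theorem IsLocalRing.isUnit_one_add_of_not_isUnit {A : Type*} [Ring A] [IsLocalRing A] {a : A}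
    (h : ¬ IsUnit a) : IsUnit (1 + a) := by
  refine (IsLocalRing.isUnit_or_isUnit_of_add_one (a := -a) (by abel : -a + (1 + a) = 1)).resolve_left ?_
  rwa [IsUnit.neg_iff]

/-- An element `a` such that every `a * p i` is in the Jacobson radical, for a decomposition
`1 = ∑ i, p i`, is itself in the Jacobson radical. -/
theorem Ring.isUnit_one_add_of_forall {A ι : Type*} [Ring A] [Fintype ι] (p : ι → A)
    (hp : ∑ i, p i = 1) (a : A) (h : ∀ i x, IsUnit (1 + x * a * p i)) : IsUnit (1 + a) := by
  -- The radical is a left ideal and `a = ∑ i, a * p i`, so it suffices that each `a * p i` is left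
  -- quasi-regular after every left multiplication.
  have hmem : a ∈ Ideal.jacobson (⊥ : Ideal A) := by
    rw [← mul_one a, ← hp, Finset.mul_sum]
    refine Ideal.sum_mem _ fun i _ => Ideal.mem_jacobson_iff.2 fun x => ?_
    obtain ⟨u, hu⟩ := h i x
    refine ⟨(↑u⁻¹ : A), ?_⟩
    have : (↑u⁻¹ : A) * (1 + x * a * p i) = 1 := by rw [← hu]; simp
    rw [Ideal.mem_bot, ← this]
    noncomm_ring
  have left (y : A) (hy : y ∈ Ideal.jacobson (⊥ : Ideal A)) : ∃ z, z * (1 + y) = 1 := by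
    obtain ⟨z, hz⟩ := Ideal.mem_jacobson_iff.1 hy 1
    rw [Ideal.mem_bot, sub_eq_zero] at hz
    exact ⟨z, .trans (by noncomm_ring) hz⟩
  obtain ⟨z, hz⟩ := left a hmem
  -- The left inverse `z` of `1 + a` is again of the form 1 plus a radical element, so it has a left
  -- inverse too, which must equal its right inverse `1 + a`.
  have hz' : z = 1 + -z * a := by
    rw [neg_mul, ← sub_eq_add_neg, eq_sub_iff_add_eq, ← mul_one_add, hz]
  obtain ⟨w, hw⟩ := left (-z * a) (Ideal.mul_mem_left _ _ hmem)
  rw [← hz'] at hw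
  have : w = 1 + a := left_inv_eq_right_inv hw hz
  exact ⟨⟨1 + a, z, this ▸ hw, hz⟩, rfl⟩

namespace Module.End

variable {R X Y : Type*} [Ring R] [AddCommGroup X] [Module R X] [AddCommGroup Y] [Module R Y]

/-- Jacobson's identity: the inverse of `1 + uv` is `1 - u (1 + vu)⁻¹ v`. It moves a unit question
from a direct sum to a single summand. -/
theorem isUnit_one_add_comp_swap (u : X →ₗ[R] Y) (v : Y →ₗ[R] X)
    (h : IsUnit (1 + v ∘ₗ u : Module.End R X)) : IsUnit (1 + u ∘ₗ v : Module.End R Y) := by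
  obtain ⟨d, hd⟩ := h
  have h1 : ∀ x, (↑d⁻¹ : Module.End R X) x + v (u ((↑d⁻¹ : Module.End R X) x)) = x := fun x => by
    have := LinearMap.congr_fun (d.mul_inv) x
    rwa [hd] at this
  have h2 : ∀ x, (↑d⁻¹ : Module.End R X) (x + v (u x)) = x := fun x => by
    have := LinearMap.congr_fun (d.inv_mul) x
    rwa [hd] at this
  refine ⟨⟨1 + u ∘ₗ v, 1 - u ∘ₗ (↑d⁻¹ : Module.End R X) ∘ₗ v, ?_, ?_⟩, rfl⟩
  · ext y
    have := congrArg u (h1 (v y))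
    simp only [map_add] at this
    simp only [mul_apply, LinearMap.add_apply, LinearMap.sub_apply, one_apply,
      LinearMap.comp_apply, map_sub]
    rw [← this]
    abel
  · ext y
    simp only [mul_apply, LinearMap.add_apply, LinearMap.sub_apply, one_apply,
      LinearMap.comp_apply]
    rw [map_add v, h2, add_sub_cancel_right]

/-- If `X` is a nonzero direct summand of a module `Y` with local endomorphism ring, then the
inclusion is an isomorphism. -/
theorem bijective_of_isUnit_comp [Nontrivial X] [IsLocalRing (Module.End R Y)] (u : X →ₗ[R] Y)
    (v : Y →ₗ[R] X) (h : IsUnit (v ∘ₗ u : Module.End R X)) : Function.Bijective u := by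
  obtain ⟨d, hd⟩ := h
  have h1 : ∀ x, v (u ((↑d⁻¹ : Module.End R X) x)) = x := fun x => by
    have := LinearMap.congr_fun (d.mul_inv) x
    rwa [hd] at this
  have h2 : ∀ x, (↑d⁻¹ : Module.End R X) (v (u x)) = x := fun x => by
    have := LinearMap.congr_fun (d.inv_mul) x
    rwa [hd] at this
  refine ⟨fun x y hxy => by rw [← h2 x, hxy, h2], ?_⟩
  -- The idempotent projecting `Y` onto the image of `u`. A local ring makes `e` or `1 - e` a unit,
  -- and `1 - e` kills the nonzero image of `u`.
  let e : Module.End R Y := u ∘ₗ (↑d⁻¹ : Module.End R X) ∘ₗ v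
  rcases IsLocalRing.isUnit_or_isUnit_of_add_one (by abel : e + (1 - e) = 1) with he | he
  · intro y
    obtain ⟨z, hz⟩ := ((Module.End.isUnit_iff _).1 he).2 y
    exact ⟨_, hz⟩
  · exfalso
    obtain ⟨x, hx⟩ := exists_ne (0 : X)
    have h0 : (1 - e) (u x) = 0 := by simp [e, h2]
    have := ((Module.End.isUnit_iff _).1 he).1 (h0.trans (map_zero _).symm)
    exact hx (by rw [← h2 x, this]; simp)

theorem nonempty_linearEquiv_of_isUnit_comp [Nontrivial X] [IsLocalRing (Module.End R Y)]
    (u : X →ₗ[R] Y) (v : Y →ₗ[R] X) (h : IsUnit (v ∘ₗ u : Module.End R X)) :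
    Nonempty (X ≃ₗ[R] Y) :=
  ⟨.ofBijective u (bijective_of_isUnit_comp u v h)⟩

theorem nontrivial_of_isLocalRing [IsLocalRing (Module.End R X)] : Nontrivial X := by
  by_contra h
  rw [not_nontrivial_iff_subsingleton] at h
  exact zero_ne_one (α := Module.End R X) (Subsingleton.elim _ _)

/-! ### Matrices of homomorphisms between finite direct sums -/

section Pi

variable {ι : Type*} [Fintype ι] [DecidableEq ι] {Z : ι → Type*}
  [∀ i, AddCommGroup (Z i)] [∀ i, Module R (Z i)]

theorem sum_single_comp_proj :
    ∑ i, LinearMap.single R Z i ∘ₗ LinearMap.proj i = (1 : Module.End R (∀ i, Z i)) := by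
  ext x j
  simp [Finset.sum_apply]

theorem comp_eq_sum_of_pi {V W : Type*} [AddCommGroup V] [Module R V] [AddCommGroup W] [Module R W]
    (f : V →ₗ[R] ∀ i, Z i) (g : (∀ i, Z i) →ₗ[R] W) :
    g ∘ₗ f = ∑ i, (g ∘ₗ LinearMap.single R Z i) ∘ₗ (LinearMap.proj i ∘ₗ f) := by
  ext x
  have := congrArg g (LinearMap.congr_fun (sum_single_comp_proj (R := R) (Z := Z)) (f x))
  simpa [LinearMap.sum_apply, map_sum] using this.symm

/-- An endomorphism of a finite direct sum of pairwise non-isomorphic modules with local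
endomorphism rings is invertible as soon as its diagonal entries are. -/
theorem isUnit_of_isUnit_diagonal [∀ i, IsLocalRing (Module.End R (Z i))]
    (hZ : ∀ i j, i ≠ j → IsEmpty (Z i ≃ₗ[R] Z j)) (f : Module.End R (∀ i, Z i))
    (hf : ∀ i, IsUnit (LinearMap.proj i ∘ₗ f ∘ₗ LinearMap.single R Z i : Module.End R (Z i))) :
    IsUnit f := by
  choose d hd using hf
  let D : Module.End R (∀ i, Z i) :=
    LinearMap.pi fun i => (d i : Module.End R (Z i)) ∘ₗ LinearMap.proj i
  let D' : Module.End R (∀ i, Z i) :=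
    LinearMap.pi fun i => (↑(d i)⁻¹ : Module.End R (Z i)) ∘ₗ LinearMap.proj i
  have hDD' : D * D' = 1 := LinearMap.ext fun x => funext fun i =>
    LinearMap.congr_fun (d i).mul_inv (x i)
  have hD'D : D' * D = 1 := LinearMap.ext fun x => funext fun i =>
    LinearMap.congr_fun (d i).inv_mul (x i)
  -- After normalising the diagonal of `f` to the identity, `a` is the off-diagonal remainder; it is
  -- shown to be radical.
  let a : Module.End R (∀ i, Z i) := D' * f - 1
  have ha (i) : LinearMap.proj i ∘ₗ a ∘ₗ LinearMap.single R Z i = 0 := by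
    ext x
    have : (↑(d i)⁻¹ : Module.End R (Z i)) (f (Pi.single i x) i) = x := by
      have := LinearMap.congr_fun (d i).inv_mul x
      rwa [hd] at this
    simp [a, D', this]
  have hunit : IsUnit (1 + a) := by
    refine Ring.isUnit_one_add_of_forall _ sum_single_comp_proj a fun i x => ?_
    -- With `p i` factored through `Z i`, the swap reduces the claim to the `(i, i)` entry of `x *
    -- a` being a non-unit of the local ring `End (Z i)`.
    refine isUnit_one_add_comp_swap ((x * a) ∘ₗ LinearMap.single R Z i) (LinearMap.proj i)
      (IsLocalRing.isUnit_one_add_of_not_isUnit fun h => ?_)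
    change IsUnit ((LinearMap.proj i ∘ₗ x) ∘ₗ (a ∘ₗ LinearMap.single R Z i)) at h
    rw [comp_eq_sum_of_pi] at h
    -- If this entry were a unit, so would be one of its summands through some `Z j`. The summand `j
    -- = i` vanishes, and any other would give an isomorphism `Z i ≃ Z j`.
    obtain ⟨j, -, hj⟩ := IsLocalRing.exists_of_isUnit_sum h
    have := nontrivial_of_isLocalRing (R := R) (X := Z i)
    by_cases hij : i = j
    · subst hij
      rw [ha, LinearMap.comp_zero] at hj
      exact not_isUnit_zero hj
    · exact (hZ i j hij).elim' (nonempty_linearEquiv_of_isUnit_comp _ _ hj).some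
  have : f = D * (1 + a) := by
    simp only [a, add_sub_cancel]
    rw [← mul_assoc, hDD', one_mul]
  rw [this]
  exact (Units.mk D D' hDD' hD'D).isUnit.mul hunit

end Pi

end Module.End

/-! ### Twisted modules -/

namespace Twist

variable {G Λ M N : Type*} [Group G] [Ring Λ] [MulSemiringAction G Λ]
  [AddCommGroup M] [Module Λ M] [AddCommGroup N] [Module Λ N]

variable (Λ G M) in
/-- Twisting by `1` does nothing. -/
def oneEquiv : Twist (1 : G) M ≃ₗ[Λ] M where
  __ := AddEquiv.refl M
  map_smul' a m := by
    change ((1 : G)⁻¹ • a) • (show M from m) = a • (show M from m)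
    rw [inv_one, one_smul]

/-- Twisting an isomorphism of twisted modules by `k`. -/
def shift (k : G) {g h : G} (e : Twist g M ≃ₗ[Λ] Twist h N) :
    Twist (k * g) M ≃ₗ[Λ] Twist (k * h) N where
  __ := e.toAddEquiv
  map_smul' a m := by
    refine .trans (congrArg e ?_) ((e.map_smul (k⁻¹ • a) m).trans ?_)
    · change ((k * g)⁻¹ • a) • (show M from m) = (g⁻¹ • k⁻¹ • a) • (show M from m)
      rw [mul_inv_rev, mul_smul]
    · change (h⁻¹ • k⁻¹ • a) • (show N from e m) = ((k * h)⁻¹ • a) • (show N from e m)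
      rw [mul_inv_rev, mul_smul]

/-- Twisting does not change the endomorphism ring. -/
def endEquiv (g : G) : Module.End Λ M ≃+* Module.End Λ (Twist g M) where
  toFun f :=
    { f.toAddMonoidHom with
      map_smul' := fun a m => f.map_smul (g⁻¹ • a) m }
  invFun f :=
    { f.toAddMonoidHom with
      map_smul' := fun a m => by
        refine .trans (congrArg f ?_) ((f.map_smul (g • a) m).trans ?_)
        · change a • m = (g⁻¹ • g • a) • m
          rw [inv_smul_smul]
        · change (g⁻¹ • g • a) • (show M from f m) = a • (show M from f m)
          rw [inv_smul_smul] }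
  left_inv _ := rfl
  right_inv _ := rfl
  map_mul' _ _ := rfl
  map_add' _ _ := rfl

/-- Twisting both sides by `g'⁻¹` reduces to the nontrivial twist by `g'⁻¹ * g`. -/
theorem isEmpty_linearEquiv (h : ∀ g : G, g ≠ 1 → IsEmpty (Twist g M ≃ₗ[Λ] N)) {g g' : G}
    (hg : g ≠ g') : IsEmpty (Twist g M ≃ₗ[Λ] Twist g' N) := by
  refine ⟨fun e => (h (g'⁻¹ * g) (by rwa [ne_eq, inv_mul_eq_one, eq_comm])).false ?_⟩
  have e' := shift g'⁻¹ e
  rw [inv_mul_cancel g'] at e'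
  exact e'.trans (oneEquiv G Λ N)

end Twist

/-! ### Homomorphisms of push-downs and their degree-1 components -/

namespace Pushdown

variable {G Λ M N P : Type*} [Group G] [Ring Λ] [MulSemiringAction G Λ]
  [AddCommGroup M] [Module Λ M] [AddCommGroup N] [Module Λ N] [AddCommGroup P] [Module Λ P]

theorem smul_pi_twist (a : Λ) (φ : ∀ g : G, Twist g M) :
    (a • φ : ∀ g : G, Twist g M) =
      (SkewMonoidAlgebra.single (1 : G) a • (of φ : Pushdown G M) : Pushdown G M) := by
  ext x
  refine Eq.trans ?_ (single_smul_apply (1 : G) a (of φ : Pushdown G M) x).symm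
  rw [inv_one, one_mul]
  rfl

/-- The restriction to `Λ` of a homomorphism of push-downs, as a homomorphism of direct sums of
twisted modules. -/
def restrict (f : Pushdown G M →ₗ[SkewMonoidAlgebra Λ G] Pushdown G N) :
    (∀ g : G, Twist g M) →ₗ[Λ] (∀ g : G, Twist g N) where
  __ := f.toAddMonoidHom
  map_smul' a φ := by
    refine .trans (congrArg f (smul_pi_twist a φ)) ((f.map_smul _ _).trans ?_)
    exact (smul_pi_twist a _).symm

/-- Being a unit means being bijective, and `restrict` leaves the underlying function unchanged. -/
theorem isUnit_of_restrict {f : Module.End (SkewMonoidAlgebra Λ G) (Pushdown G M)}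
    (h : IsUnit (restrict f : Module.End Λ (∀ g : G, Twist g M))) : IsUnit f :=
  (Module.End.isUnit_iff f).2 ((Module.End.isUnit_iff (restrict f)).1 h)

theorem unit_apply_one (m : M) : unit G m 1 = m := if_pos rfl

theorem unit_add (m n : M) : unit G (m + n) = unit G m + unit G n := by
  ext x; by_cases h : x = 1 <;> simp [unit, h]

theorem unit_smul (a : Λ) (m : M) :
    unit G (a • m) = SkewMonoidAlgebra.single (1 : G) a • unit G m := by
  ext x
  rw [single_smul_apply]
  by_cases h : x = 1 <;> simp [unit, h]

/-- The component `M → N` in degree `1` of a homomorphism of push-downs. -/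
def component (f : Pushdown G M →ₗ[SkewMonoidAlgebra Λ G] Pushdown G N) : M →ₗ[Λ] N where
  toFun m := f (unit G m) 1
  map_add' m n := by rw [unit_add, map_add, add_apply]
  map_smul' a m := by rw [unit_smul, map_smul, single_smul_apply]; simp

/-- A pushed-down homomorphism preserves degrees, so evaluating the equation at `1 ⊗ l` in degree 1
recovers the triangle over `Λ`. This is what makes components of pointed homomorphisms pointed. -/
theorem component_comp_pt (f : Pushdown G M →ₗ[SkewMonoidAlgebra Λ G] Pushdown G N)
    {u : P →ₗ[Λ] M} {v : P →ₗ[Λ] N} (h : f ∘ₗ map u = map v) : component f ∘ₗ u = v := by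
  ext l
  have h1 : map u (unit G l) = unit G (u l) := by
    ext x; by_cases h : x = 1 <;> simp [unit, h]
  have := DFunLike.congr_fun (LinearMap.congr_fun h (unit G l)) (1 : G)
  rw [LinearMap.comp_apply, h1] at this
  exact this.trans (congrArg v (unit_apply_one l))

/-- Since `g ⊗ m = g • (1 ⊗ m)` and `f` commutes with the group elements, every diagonal entry of
`f` is the same additive map as the one in degree 1. -/
theorem restrict_single_apply [DecidableEq G]
    (f : Pushdown G M →ₗ[SkewMonoidAlgebra Λ G] Pushdown G N) (g : G) (m : M) :
    restrict f (LinearMap.single Λ (fun g => Twist g M) g m) g = component f m := by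
  have h : (LinearMap.single Λ (fun g => Twist g M) g m : ∀ g : G, Twist g M) =
      (SkewMonoidAlgebra.single g (1 : Λ) • unit G m : Pushdown G M) := by
    ext x
    refine Eq.trans ?_ (single_smul_apply g (1 : Λ) (unit G m) x).symm
    by_cases hx : x = g
    · subst hx
      refine (Pi.single_eq_same (M := fun g : G => Twist g M) x m).trans ?_
      simp [unit_apply_one]
      rfl
    · have : g⁻¹ * x ≠ 1 := by rwa [ne_eq, inv_mul_eq_one, eq_comm]
      refine (Pi.single_eq_of_ne (M := fun g : G => Twist g M) hx m).trans ?_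
      simp only [unit, of_apply, if_neg this, smul_zero]
      rfl
  refine (congrFun (congrArg f h) g).trans ?_
  refine (DFunLike.congr_fun (f.map_smul _ _) g).trans ?_
  refine (single_smul_apply _ _ _ _).trans ?_
  rw [smul_one, one_smul, inv_mul_cancel]
  rfl

variable [Finite G]

/-- The diagonal entries of `restrict f` are twists of one unit, and the summands `ᵍM` are pairwise
non-isomorphic, so the diagonal criterion applies. -/
theorem isUnit_of_isUnit_component [IsLocalRing (Module.End Λ M)]
    (hM : ∀ g : G, g ≠ 1 → IsEmpty (Twist g M ≃ₗ[Λ] M))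
    (f : Module.End (SkewMonoidAlgebra Λ G) (Pushdown G M))
    (hf : IsUnit (component f : Module.End Λ M)) : IsUnit f := by
  classical
  have := Fintype.ofFinite G
  have (g : G) : IsLocalRing (Module.End Λ (Twist g M)) := .of_ringEquiv (Twist.endEquiv g)
  refine isUnit_of_restrict (Module.End.isUnit_of_isUnit_diagonal
    (fun i j hij => Twist.isEmpty_linearEquiv hM hij) _ fun g => ?_)
  have : LinearMap.proj g ∘ₗ restrict f ∘ₗ LinearMap.single Λ (fun g => Twist g M) g =
      Twist.endEquiv g (component f) := LinearMap.ext fun m => restrict_single_apply f g m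
  rw [this]
  exact hf.map (Twist.endEquiv g)

/-- The push-down of a module with local endomorphism ring which is not isomorphic to its
nontrivial twists has a local endomorphism ring. -/
theorem isLocalRing_end [IsLocalRing (Module.End Λ M)]
    (hM : ∀ g : G, g ≠ 1 → IsEmpty (Twist g M ≃ₗ[Λ] M)) :
    IsLocalRing (Module.End (SkewMonoidAlgebra Λ G) (Pushdown G M)) := by
  have : Nontrivial M := Module.End.nontrivial_of_isLocalRing (R := Λ)
  have : Nontrivial (Pushdown G M) := inferInstanceAs (Nontrivial (G → M))
  refine ⟨fun {a b} hab => ?_⟩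
  -- Additivity of `component` suffices here: the two components sum to 1 in the local ring `End M`,
  -- and invertibility then lifts.
  have h : (component a + component b : Module.End Λ M) = 1 := by
    ext m
    have := DFunLike.congr_fun (LinearMap.congr_fun hab (unit G m)) (1 : G)
    exact this.trans (unit_apply_one m)
  exact (IsLocalRing.isUnit_or_isUnit_of_add_one h).imp
    (isUnit_of_isUnit_component hM a) (isUnit_of_isUnit_component hM b)

/-- If no nontrivial twist of `N` is isomorphic to `M`, the component in degree `1` of an
isomorphism of push-downs is an isomorphism. -/
theorem bijective_component [IsLocalRing (Module.End Λ M)] [IsLocalRing (Module.End Λ N)]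
    (hM : ∀ g : G, g ≠ 1 → IsEmpty (Twist g M ≃ₗ[Λ] N))
    (e : Pushdown G M ≃ₗ[SkewMonoidAlgebra Λ G] Pushdown G N) :
    Function.Bijective (component e.toLinearMap) := by
  classical
  have := Fintype.ofFinite G
  have : Nontrivial M := Module.End.nontrivial_of_isLocalRing (R := Λ)
  have hlM (g : G) : IsLocalRing (Module.End Λ (Twist g M)) := .of_ringEquiv (Twist.endEquiv g)
  have hlN (g : G) : IsLocalRing (Module.End Λ (Twist g N)) := .of_ringEquiv (Twist.endEquiv g)
  have : Nontrivial (Twist (1 : G) M) := inferInstanceAs (Nontrivial M)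
  let u := restrict e.toLinearMap ∘ₗ LinearMap.single Λ (fun g : G => Twist g M) 1
  let v := LinearMap.proj (R := Λ) (φ := fun g : G => Twist g M) 1 ∘ₗ restrict e.symm.toLinearMap
  have huv : v ∘ₗ u = 1 := by
    ext m
    have : restrict e.symm.toLinearMap (u m) =
        LinearMap.single Λ (fun g : G => Twist g M) 1 m := e.symm_apply_apply _
    refine (congrFun this 1).trans ?_
    simp
  have hsum : IsUnit (v ∘ₗ u : Module.End Λ (Twist (1 : G) M)) := huv ▸ isUnit_one
  -- The identity of `M` is the sum of its passages through the summands `ᵍN`. By locality one of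
  -- them is a unit, so `M` is isomorphic to that `ᵍN`; the hypothesis on twists forces `g = 1`.
  rw [Module.End.comp_eq_sum_of_pi] at hsum
  obtain ⟨g, -, hg⟩ := IsLocalRing.exists_of_isUnit_sum hsum
  have hb := Module.End.bijective_of_isUnit_comp _ _ hg
  by_cases h1 : 1 = g
  · subst h1
    have key (m : M) := restrict_single_apply e.toLinearMap (1 : G) m
    exact ⟨fun m n hmn => hb.1 ((key m).trans (hmn.trans (key n).symm)),
      fun n => (hb.2 n).imp fun m hm => (key m).symm.trans hm⟩
  · exact ((Twist.isEmpty_linearEquiv hM h1).false (.ofBijective _ hb)).elim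

end Pushdown

/-! ### Push-down of pointed modules and of their lattice -/

namespace PointedModule

universe v u w

section

variable {R : Type u} [Ring R] {θ : Type w} [AddCommGroup θ] [Module R θ]
  {M N L : PointedModule.{v} R θ}

theorem IsIso.symm : IsIso M N → IsIso N M := fun ⟨e, he⟩ =>
  ⟨e.symm, by ext l; simp [← he]⟩

theorem IsIso.trans : IsIso M N → IsIso N L → IsIso M L := fun ⟨e, he⟩ ⟨f, hf⟩ =>
  ⟨e.trans f, by rw [← hf, ← he]; rfl⟩

theorem IsIso.hasHom : IsIso M N → HasHom M N := fun ⟨e, he⟩ => ⟨e.toLinearMap, he⟩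

theorem IsIso.cls_eq (h : IsIso M N) : cls M = cls N :=
  le_antisymm ((cls_le_cls_iff _ _).2 h.symm.hasHom) ((cls_le_cls_iff _ _).2 h.hasHom)

end

variable {G : Type*} [Group G] [Finite G] {R : Type u} [Ring R] [MulSemiringAction G R]
  {θ : Type w} [AddCommGroup θ] [Module R θ] {M N : PointedModule.{v} R θ}

/-- Reflection comes from `component`, with no condition on endomorphism rings or twists; this alone
makes the push-down an order embedding on classes. -/
theorem hasHom_pushdown_iff : HasHom (M.pushdown G) (N.pushdown G) ↔ HasHom M N :=
  ⟨fun ⟨f, hf⟩ => ⟨_, Pushdown.component_comp_pt f hf⟩,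
    fun ⟨f, hf⟩ => ⟨Pushdown.map f, congrArg (Pushdown.map (G := G)) hf⟩⟩

theorem pt_eq_zero_of_pushdown (h : (M.pushdown G).pt = 0) : M.pt = 0 :=
  (Pushdown.component_comp_pt (u := M.pt) (0 : Pushdown G M.carrier →ₗ[SkewMonoidAlgebra R G] _)
    ((LinearMap.zero_comp _).trans h.symm)).symm.trans (by ext; rfl)

theorem isIso_of_pushdown (hM : IsLocalRing (Module.End R M.carrier))
    (hN : IsLocalRing (Module.End R N.carrier))
    (h : ∀ g : G, g ≠ 1 → IsEmpty (Twist g M.carrier ≃ₗ[R] N.carrier)) :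
    IsIso (M.pushdown G) (N.pushdown G) → IsIso M N := fun ⟨e, he⟩ =>
  ⟨.ofBijective _ (Pushdown.bijective_component h e), Pushdown.component_comp_pt _ he⟩

variable (G M N) in
/-- The push-down commutes with pushouts. -/
theorem isIso_pushout_pushdown [Module.FinitePresentation R θ] :
    IsIso (pushout (M.pushdown G) (N.pushdown G)) ((pushout M N).pushdown G) := by
  let f : Pushdown G M.carrier × Pushdown G N.carrier →ₗ[SkewMonoidAlgebra R G]
      Pushdown G (pushout M N).carrier :=
    (Pushdown.map ((pushoutRel M N).mkQ ∘ₗ LinearMap.inl R _ _)).coprod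
      (Pushdown.map ((pushoutRel M N).mkQ ∘ₗ LinearMap.inr R _ _))
  have hf (φ ψ) (x : G) : f (φ, ψ) x = (pushoutRel M N).mkQ (φ x, ψ x) := by
    simp only [f, LinearMap.coprod_apply, Pushdown.add_apply, Pushdown.map_apply,
      LinearMap.comp_apply, ← map_add]
    simp
  have hsurj : Function.Surjective f := fun ψ => by
    choose y hy using fun x => (pushoutRel M N).mkQ_surjective (ψ x)
    exact ⟨(Pushdown.of fun x => (y x).1, Pushdown.of fun x => (y x).2),
      Pushdown.ext fun x => (hf _ _ x).trans (hy x)⟩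
  have hker : pushoutRel (M.pushdown G) (N.pushdown G) = LinearMap.ker f := by
    ext ⟨φ, ψ⟩
    constructor
    · rintro ⟨l, hl⟩
      cases hl
      refine Pushdown.ext fun x => (hf _ _ x).trans ?_
      rw [Submodule.mkQ_apply, Pushdown.zero_apply, Submodule.Quotient.mk_eq_zero]
      exact ⟨l x, rfl⟩
    · intro h
      have h' (x : G) : (φ x, ψ x) ∈ pushoutRel M N := by
        rw [← Submodule.Quotient.mk_eq_zero, ← Submodule.mkQ_apply, ← hf]
        exact DFunLike.congr_fun h x
      -- Membership in the relation submodule holds degree by degree, and the elements of `θ` chosen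
      -- in each degree assemble into one element of the push-down of `θ`.
      choose l hl using h'
      exact ⟨Pushdown.of l, Prod.ext (Pushdown.ext fun x => congrArg Prod.fst (hl x))
        (Pushdown.ext fun x => congrArg Prod.snd (hl x))⟩
  refine ⟨(Submodule.quotEquivOfEq _ _ hker).trans (f.quotKerEquivOfSurjective hsurj), ?_⟩
  ext l x
  exact hf _ _ x

variable (G M N) in
/-- The push-down commutes with direct sums. -/
theorem isIso_directSum_pushdown :
    IsIso ((directSum M N).pushdown G) (directSum (M.pushdown G) (N.pushdown G)) :=
  ⟨{ (Pushdown.map (LinearMap.fst R _ _)).prod (Pushdown.map (LinearMap.snd R _ _)) with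
      invFun := fun φ => Pushdown.of fun x => (φ.1 x, φ.2 x)
      left_inv := fun _ => rfl
      right_inv := fun _ => rfl }, rfl⟩

theorem cls_pushdown_le_iff : cls (M.pushdown G) ≤ cls (N.pushdown G) ↔ cls M ≤ cls N :=
  hasHom_pushdown_iff

variable (G R θ) in
/-- The push-down, as an embedding of the lattices of pointed modules. -/
def pushdownLatticeHom [Module.FinitePresentation R θ] :
    LatticeHom (Classes.{v} R θ) (Classes (SkewMonoidAlgebra R G) (Pushdown G θ)) where
  toFun := Quotient.lift (fun M => cls (M.pushdown G)) fun _ _ h =>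
    le_antisymm (cls_pushdown_le_iff.2 h.1) (cls_pushdown_le_iff.2 h.2)
  map_sup' := by
    rintro ⟨M⟩ ⟨N⟩
    exact (isIso_directSum_pushdown G M N).cls_eq
  map_inf' := by
    rintro ⟨M⟩ ⟨N⟩
    exact (isIso_pushout_pushdown G M N).cls_eq.symm

theorem pushdownLatticeHom_injective [Module.FinitePresentation R θ] :
    Function.Injective (pushdownLatticeHom.{v} G R θ) := by
  rintro ⟨M⟩ ⟨N⟩ h
  exact le_antisymm (cls_pushdown_le_iff.1 h.le) (cls_pushdown_le_iff.1 h.ge)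

/-! ### Transfer of dense chains and independent pairs -/

section Pairs

variable {C₁ C₂ : Type*}
  [LinearOrder C₁] [DenselyOrdered C₁] [NoMinOrder C₁] [NoMaxOrder C₁] [Nonempty C₁]
  [LinearOrder C₂] [DenselyOrdered C₂] [NoMinOrder C₂] [NoMaxOrder C₂] [Nonempty C₂]

theorem IsDenseChain.pushdown {M : C₁ → PointedModule.{v} R θ} (hM : IsDenseChain M)
    (h : ∀ g : G, g ≠ 1 → ∀ q₁ q₂, IsEmpty (Twist g (M q₁).carrier ≃ₗ[R] (M q₂).carrier)) :
    IsDenseChain fun q => (M q).pushdown G where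
  isLocalRing_end q :=
    have := hM.isLocalRing_end q
    Pushdown.isLocalRing_end fun g hg => h g hg q q
  pt_ne_zero q hq := hM.pt_ne_zero q (pt_eq_zero_of_pushdown hq)
  hasHom q q' hq := hasHom_pushdown_iff.2 (hM.hasHom q q' hq)
  not_isIso q q' hq hi := hM.not_isIso q q' hq
    (isIso_of_pushdown (hM.isLocalRing_end q) (hM.isLocalRing_end q') (fun g hg => h g hg q q') hi)

theorem IsNonsymmetricPair.pushdown [Module.FinitePresentation R θ]
    {M : C₁ → PointedModule.{v} R θ} {N : C₂ → PointedModule.{v} R θ}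
    (h : IsNonsymmetricPair G M N) :
    IsIndependentPair (fun q => (M q).pushdown G) (fun t => (N t).pushdown G) where
  left := h.left.pushdown h.left_twist
  right := h.right.pushdown h.right_twist
  isLocalRing_end q t := by
    have := h.isLocalRing_end q t
    have := Pushdown.isLocalRing_end fun g hg => h.pushout_twist g hg q t q t
    -- Locality is known for the push-down of the pushout and is carried to the pushout of the
    -- push-downs by conjugation.
    exact .of_ringEquiv (isIso_pushout_pushdown G (M q) (N t)).choose.symm.conjRingEquiv
  not_isIso_left q q' t hq hi := h.not_isIso_left q q' t hq
    (isIso_of_pushdown (h.isLocalRing_end q t) (h.isLocalRing_end q' t)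
      (fun g hg => h.pushout_twist g hg q t q' t)
      ((isIso_pushout_pushdown G _ _).symm.trans (hi.trans (isIso_pushout_pushdown G _ _))))
  not_isIso_right q t t' ht hi := h.not_isIso_right q t t' ht
    (isIso_of_pushdown (h.isLocalRing_end q t) (h.isLocalRing_end q t')
      (fun g hg => h.pushout_twist g hg q t q t')
      ((isIso_pushout_pushdown G _ _).symm.trans (hi.trans (isIso_pushout_pushdown G _ _))))

end Pairs

end PointedModule

/-- An injective lattice homomorphism is an order embedding, because `a ≤ b` means `a ⊓ b = a`;
wideness involves only order, meets and joins. -/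
theorem IsWide.image {L L' : Type*} [Lattice L] [Lattice L'] {S : Set L} (hS : IsWide S)
    (f : LatticeHom L L') (hf : Function.Injective f) : IsWide (f '' S) := by
  have hle {a b : L} : f a ≤ f b ↔ a ≤ b := by
    rw [← inf_eq_left, ← map_inf, hf.eq_iff, inf_eq_left]
  have hlt {a b : L} : f a < f b ↔ a < b := by simp only [lt_iff_le_not_ge, hle]
  rintro _ ⟨a, ha, rfl⟩ _ ⟨b, hb, rfl⟩ hab
  obtain ⟨c, hc, d, hd, h⟩ := hS a ha b hb (hlt.1 hab)
  refine ⟨f c, ⟨c, hc, rfl⟩, f d, ⟨d, hd, rfl⟩, ?_⟩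
  simpa only [← map_inf, ← map_sup, hle, hlt] using h

end

theorem theorem3p7
    {K : Type*} [Field K] (hK : ringChar K ≠ 2)
    {Λ : Type*} [Ring Λ] [Algebra K Λ] [Module.Finite K Λ]
    {G : Type*} [Group G] [Finite G] [MulSemiringAction G Λ] [SMulCommClass G K Λ]
    {θ : Type*} [AddCommGroup θ] [Module Λ θ] [Module.FinitePresentation Λ θ]
    (hθ : IsSemisimpleModule Λ θ) :
    (∀ {C₁ C₂ : Type*}
        [LinearOrder C₁] [DenselyOrdered C₁] [NoMinOrder C₁] [NoMaxOrder C₁] [Nonempty C₁]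
        [LinearOrder C₂] [DenselyOrdered C₂] [NoMinOrder C₂] [NoMaxOrder C₂] [Nonempty C₂]
        (M : C₁ → PointedModule Λ θ) (N : C₂ → PointedModule Λ θ),
        PointedModule.IsNonsymmetricPair G M N →
          PointedModule.IsIndependentPair (fun q => (M q).pushdown G)
            (fun t => (N t).pushdown G)) ∧
    (∀ {P : Type*} (M : P → PointedModule Λ θ),
        IsWide (Set.range fun p => PointedModule.cls (M p)) →
          IsWide (Set.range fun p => PointedModule.cls ((M p).pushdown G)) ∧
          ((∃ p p', PointedModule.cls (M p) < PointedModule.cls (M p')) →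
            ∃ p p', PointedModule.cls ((M p).pushdown G) <
              PointedModule.cls ((M p').pushdown G))) := by

  refine ⟨fun M N h => h.pushdown, fun M h => ⟨?_, fun ⟨p, p', hp⟩ => ⟨p, p', ?_⟩⟩⟩
  -- The classes of the pushed-down family are exactly the image of the original classes under the
  -- lattice embedding.
  · convert h.image (PointedModule.pushdownLatticeHom G Λ θ)
      PointedModule.pushdownLatticeHom_injective using 1
    rw [← Set.range_comp]
    rfl
  · exact ⟨PointedModule.cls_pushdown_le_iff.2 hp.1, fun h =>
      hp.2 (PointedModule.cls_pushdown_le_iff.1 h)⟩
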